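/- A random walk program $\mathcal{P}$ is a program with one integer variable $x$ of the form $$\texttt{while } (x>0)\ \{\ x = x+m\ [p_m];\ \ldots;\ x=x+1\ [p_1];\ x = x\ [p_0];\ x=x-1\ [p_{-1}];\ \ldots;\ x = x-k\ [p_{-k}];\ x = d\ [p'];\ \}$$ where $m,k\in\mathbb{N}$ (possibly $0$), $d\in\mathbb{Z}$ with $d\le 0$, the constants $p_m,\ldots,p_{-k},p'\in\mathbb{R}_{\ge 0}$ satisfy $\sum_{-k\le j\le m}p_j+p'=1$, and $m>0$ implies $p_m>0$, and $k>0$ implies $p_{-k}>0$. In every loop iteration exactly one instruction is executed, with the probability given in brackets. So the program is a Markov chain on $\mathbb{Z}$: from a state $x>0$ it moves to $x+j$ with probability $p_j$ (for $-k\le j\le m$) and to $d$ with probability $p'$ (adding the probabilities of instructions that lead to the same state), and it stays forever in any state $x\le 0$. Let $\mathbb{P}_{x_0}$ be the probability measure on $\mathbb{Z}^{\mathbb{N}}$ (with the $\sigma$-field generated by the cylinder sets) that this chain induces when started in $x_0\in\mathbb{Z}$, let $\mathbb{E}_{x_0}$ be the corresponding expectation, and let $T(\langle z_0,z_1,\ldots\rangle)=\inf\{j\in\mathbb{N}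 \mid z_j\le 0\}\in\mathbb{N}\cup\{\infty\}$ be the termination time. The program is almost surely terminating (AST) if $\mathbb{P}_{x_0}(T<\infty)=1$ for all $x_0\in\mathbb{Z}$, and positively almost surely terminating (PAST) if $\mathbb{E}_{x_0}(T)<\infty$ for all $x_0\in\mathbb{Z}$. It has direct termination if $p'>0$. It is trivial if it is the program $\texttt{while } (x>0)\ \{\ x=x\ [1];\ \}$, i.e., $m=k=0$ and $p_0=1$. Its drift is $\mu_{\mathcal{P}}=\sum_{-k\le j\le m} j\cdot p_j$. **Theorem (Decision Procedure for (P)AST of Random Walk Programs).** Let $\mathcal{P}$ be a non-trivial random walk program without direct termination. - If $\mu_{\mathcal{P}}>0$, then $\mathcal{P}$ is not AST. - If $\mu_{\mathcal{P}}=0$, then $\mathcal{P}$ is AST but not PAST. - If $\mu_{\mathcal{P}}<0$, then $\mathcal{P}$ is PAST. -/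

import Mathlib

open MeasureTheory ProbabilityTheory
open scoped NNReal ENNReal

noncomputable section

/-- A probabilistic program over `r` integer program variables:
`while (a • x > b) { x = x + c [p c x] (for every c in updates);  x = d [pDirect x]; }`.
In each iteration exactly one of the instructions is executed, with the probability in brackets,
which may depend on the current state `x`. The values `p c` for `c ∉ updates` are never used. -/
structure ProbProgram (r : ℕ) where
  a : Fin r → ℤ
  b : ℤ
  updates : Finset (Fin r → ℤ)
  p : (Fin r → ℤ) → (Fin r → ℤ) → ℝ≥0
  d : Fin r → ℤ
  pDirect : (Fin r → ℤ) → ℝ≥0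
  dot_d_le : a ⬝ᵥ d ≤ b
  sum_eq_one : ∀ x, ∑ c ∈ updates, p c x + pDirect x = 1

namespace ProbProgram

variable {r : ℕ} (P : ProbProgram r)

/-- The loop guard `a • x > b`. -/
def Guard (x : Fin r → ℤ) : Prop := P.b < P.a ⬝ᵥ x

/-- The program can leave the loop by its last instruction `x = d`. -/
def HasDirectTermination : Prop := ∃ x, P.Guard x ∧ 0 < P.pDirect x

open Classical in
/-- The law of the next state: one loop iteration if the guard holds, and otherwise the state
is kept. -/
def stepMeasure (x : Fin r → ℤ) : Measure (Fin r → ℤ) :=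
  if P.Guard x then
    ∑ c ∈ P.updates, P.p c x • Measure.dirac (x + c) + P.pDirect x • Measure.dirac P.d
  else Measure.dirac x

instance (x : Fin r → ℤ) : IsProbabilityMeasure (P.stepMeasure x) := by
  unfold stepMeasure
  split_ifs
  · constructor
    rw [Measure.add_apply, Measure.finsetSum_apply]
    simp only [Measure.smul_apply, measure_univ, ENNReal.smul_def, smul_eq_mul, mul_one]
    exact_mod_cast congrArg (fun t : ℝ≥0 => (t : ℝ≥0∞)) (P.sum_eq_one x)
  · infer_instance

/-- The transition kernel of the program, a Markov chain on `ℤ ^ r`. -/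
def step : Kernel (Fin r → ℤ) (Fin r → ℤ) := Kernel.ofFunOfCountable P.stepMeasure

instance : IsMarkovKernel P.step :=
  ⟨fun x => inferInstanceAs (IsProbabilityMeasure (P.stepMeasure x))⟩

/-- The transition kernel from the history `z 0, …, z n` to the state at time `n + 1`. -/
def historyStep (n : ℕ) : Kernel (Finset.Iic n → Fin r → ℤ) (Fin r → ℤ) :=
  P.step.comap (fun h => h ⟨n, Finset.mem_Iic.2 le_rfl⟩) (measurable_pi_apply _)

instance (n : ℕ) : IsMarkovKernel (P.historyStep n) :=
  inferInstanceAs (IsMarkovKernel (P.step.comap _ (measurable_pi_apply _)))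

/-- The probability measure on the infinite runs of the program with initial state `x`, from the
Ionescu-Tulcea theorem (the cylinder-set construction). -/
def runMeasure (x : Fin r → ℤ) : Measure (ℕ → Fin r → ℤ) :=
  Kernel.traj (X := fun _ => Fin r → ℤ) P.historyStep 0 (fun _ => x)

/-- The first index at which the run `z` violates the guard, `⊤` if there is none. -/
def terminationTime (z : ℕ → Fin r → ℤ) : ℕ∞ :=
  ⨅ (j : ℕ) (_ : ¬ P.Guard (z j)), (j : ℕ∞)

/-- Almost sure termination, from every initial state. -/
def AST : Prop := ∀ x, P.runMeasure x {z | P.terminationTime z < ⊤} = 1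

/-- The expected number of loop iterations from the initial state `x`. -/
def expectedRuntime (x : Fin r → ℤ) : ℝ≥0∞ :=
  ∫⁻ z, (P.terminationTime z : ℝ≥0∞) ∂P.runMeasure x

/-- Positive almost sure termination: finite expected runtime from every initial state. -/
def PAST : Prop := ∀ x, P.expectedRuntime x < ∞

end ProbProgram

/-- A random walk program
`while (x > 0) { x = x + m [p m]; …; x = x - k [p (-k)];  x = d [pDirect]; }`
with one program variable and constant probabilities. The values `p j` for `j` outside `[-k, m]`
are never used. -/
structure RandomWalkProgram where
  m : ℕ
  k : ℕ
  d : ℤ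
  p : ℤ → ℝ≥0
  pDirect : ℝ≥0
  d_nonpos : d ≤ 0
  sum_eq_one : ∑ j ∈ Finset.Icc (-(k : ℤ)) m, p j + pDirect = 1
  p_m_pos : 0 < m → 0 < p m
  p_neg_k_pos : 0 < k → 0 < p (-(k : ℤ))

namespace RandomWalkProgram

variable (P : RandomWalkProgram)

/-- A random walk program as a probabilistic program with a single variable: guard `1 * x > 0`. -/
def toProbProgram : ProbProgram 1 where
  a := fun _ => 1
  b := 0
  updates := (Finset.Icc (-(P.k : ℤ)) P.m).image (fun j _ => j)
  p := fun c _ => P.p (c 0)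
  d := fun _ => P.d
  pDirect := fun _ => P.pDirect
  dot_d_le := by simpa [dotProduct] using P.d_nonpos
  sum_eq_one := fun x => by
    rw [Finset.sum_image (fun i _ j _ h => congrFun h 0)]
    exact P.sum_eq_one

/-- The program is `while (x > 0) { x = x [1]; }`. -/
def IsTrivial : Prop := P.m = 0 ∧ P.k = 0 ∧ P.p 0 = 1

/-- The expected change of the program variable in one loop iteration. -/
def drift : ℝ := ∑ j ∈ Finset.Icc (-(P.k : ℤ)) P.m, (j : ℝ) * P.p j

end RandomWalkProgram

end

/-!
The theorem is proved with Lyapunov functions for the chain `z 0, z 1, …` of program states. Nothing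
is used about the measure on runs except the Markov property for two consecutive states
(`ProbProgram.lintegral_runMeasure_succ`). As terminated runs stay where they are, the probability
of termination is the limit of `ℙ (z n ≤ 0)` (`ProbProgram.tendsto_runMeasure_not_guard`) and the
expected runtime is `∑ n, ℙ (0 < z n)` (`ProbProgram.expectedRuntime_eq_tsum`).

Let `V x = max (x + k) 0`. From `x > 0` the chain moves to states `≥ 1 - k`, so `V` is nonnegative and
still changes by exactly the drift on average. Truncation at `0` makes `V` usable with extended
nonnegative integrals throughout.

* Negative drift `μ`: `𝔼 V (z (n + 1)) = 𝔼 V (z n) - |μ| * ℙ (0 < z n)`, and summation bounds the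
  expected runtime by `V (z 0) / |μ|`.
* Positive drift: for some `0 < θ < 1` the sequence `θ ^ z n` is a supermartingale. It is at least `1`
  after termination, so from the state `1` termination has probability at most `θ`.
* Zero drift: `𝔼 V (z n)` is constant. The walk is at most `1 + m * n` at time `n` when started in
  `1`, so constancy forces `ℙ (0 < z n) ≥ 1 / (1 + m * n)`, and the harmonic series makes the expected
  runtime infinite. For almost sure termination, Markov's inequality gives
  `ℙ (z n > k * N) ≤ V (z 0) / N`, while from a state in `(0, k * N]` the loop is left within `N`
  iterations with probability at least `p (-k) ^ N > 0`. As `ℙ (z n ≤ 0)` converges, the mass in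
  `(0, k * N]` tends to `0`, so the probability of running forever is at most `V (z 0) / N` for
  all `N`. Nontriviality gives `m > 0` and `k > 0` here (`RandomWalkProgram.pos_of_drift_eq_zero`).
-/

open Filter Topology

/-! ### Runs of a probabilistic program -/

namespace ProbProgram

variable {r : ℕ} (P : ProbProgram r) (x : Fin r → ℤ)

instance : IsProbabilityMeasure (P.runMeasure x) :=
  inferInstanceAs (IsProbabilityMeasure (Kernel.traj (X := fun _ => Fin r → ℤ) P.historyStep 0 _))

/-- The Markov property of the runs, for functions of two consecutive states. -/
theorem lintegral_runMeasure_succ (n : ℕ) (g : (Fin r → ℤ) → (Fin r → ℤ) → ℝ≥0∞) :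
    ∫⁻ z, g (z n) (z (n + 1)) ∂P.runMeasure x
      = ∫⁻ z, ∫⁻ y, g (z n) y ∂P.stepMeasure (z n) ∂P.runMeasure x := by
  let last : (Finset.Iic n → Fin r → ℤ) → Fin r → ℤ := fun h => h ⟨n, Finset.mem_Iic.2 le_rfl⟩
  have hlast : Measurable last := measurable_pi_apply _
  have hg : Measurable (Function.uncurry g) := .of_discrete
  have hG : Measurable fun q : (Finset.Iic n → Fin r → ℤ) × (Fin r → ℤ) => g (last q.1) q.2 :=
    hg.comp ((hlast.comp measurable_fst).prodMk measurable_snd)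
  have hI : Measurable fun y => ∫⁻ y', g y y' ∂P.stepMeasure y := .of_discrete
  have key := Kernel.partialTraj_compProd_eq_map_traj (X := fun _ => Fin r → ℤ)
    (κ := P.historyStep) (Nat.zero_le n) (x₀ := fun _ => x)
  calc
    _ = ∫⁻ q, g (last q.1) q.2 ∂((P.runMeasure x).map
          fun z => (Preorder.frestrictLe n z, z (n + 1))) := by
      rw [lintegral_map hG (by fun_prop)]
      rfl
    _ = ∫⁻ h, ∫⁻ y, g (last h) y ∂P.stepMeasure (last h)
          ∂(Kernel.partialTraj (X := fun _ => Fin r → ℤ) P.historyStep 0 n fun _ => x) := by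
      rw [runMeasure, ← key, Measure.lintegral_compProd hG]
      rfl
    _ = _ := by
      rw [← Kernel.traj_map_frestrictLe_apply, lintegral_map
        (f := fun h => ∫⁻ y, g (last h) y ∂P.stepMeasure (last h)) (hI.comp hlast) (by fun_prop)]
      rfl

theorem lintegral_runMeasure_zero (f : (Fin r → ℤ) → ℝ≥0∞) :
    ∫⁻ z, f (z 0) ∂P.runMeasure x = f x := by
  have hf : Measurable f := .of_discrete
  have hf0 : Measurable fun z : ℕ → Fin r → ℤ => f (z 0) := hf.comp (measurable_pi_apply 0)
  rw [runMeasure, Kernel.lintegral_traj _ hf0]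
  simp [Function.updateFinset]

/-- A relation that one iteration almost surely establishes between the old and the new state
almost surely holds along the whole run. -/
theorem ae_runMeasure_step {R : (Fin r → ℤ) → (Fin r → ℤ) → Prop}
    (hR : ∀ y, ∀ᵐ y' ∂P.stepMeasure y, R y y') :
    ∀ᵐ z ∂P.runMeasure x, ∀ n, R (z n) (z (n + 1)) := by
  classical
  refine ae_all_iff.2 fun n => ?_
  have h := P.lintegral_runMeasure_succ x n fun y y' => if R y y' then 0 else 1
  have h0 : ∀ y, ∫⁻ y', (if R y y' then 0 else 1 : ℝ≥0∞) ∂P.stepMeasure y = 0 := fun y => by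
    rw [lintegral_eq_zero_iff (.of_discrete)]
    filter_upwards [hR y] with y' hy'
    simp [hy']
  simp only [h0, lintegral_zero] at h
  have hm : Measurable (Function.uncurry fun y y' => if R y y' then (0 : ℝ≥0∞) else 1) :=
    .of_discrete
  have hmz : Measurable fun z : ℕ → Fin r → ℤ =>
      if R (z n) (z (n + 1)) then (0 : ℝ≥0∞) else 1 := by
    have := hm.comp (show Measurable fun z : ℕ → Fin r → ℤ => (z n, z (n + 1)) by fun_prop)
    exact this
  rw [lintegral_eq_zero_iff hmz] at h
  filter_upwards [h] with z hz
  by_contra hcon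
  simp [hcon] at hz

theorem ae_runMeasure_absorbed :
    ∀ᵐ z ∂P.runMeasure x, ∀ n i, n ≤ i → ¬ P.Guard (z n) → ¬ P.Guard (z i) := by
  have h := P.ae_runMeasure_step x (R := fun y y' => ¬ P.Guard y → ¬ P.Guard y') fun y => by
    by_cases hy : P.Guard y
    · simp [hy]
    · simp [stepMeasure, hy]
  filter_upwards [h] with z hz n i hni hn
  induction i, hni using Nat.le_induction with
  | base => exact hn
  | succ i _ ih => exact hz i ih

theorem measurableSet_state (n : ℕ) (s : Set (Fin r → ℤ)) :
    MeasurableSet {z : ℕ → Fin r → ℤ | z n ∈ s} :=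
  measurable_pi_apply n (MeasurableSet.of_discrete (s := s))

theorem terminationTime_lt_top_iff (z : ℕ → Fin r → ℤ) :
    P.terminationTime z < ⊤ ↔ ∃ n, ¬ P.Guard (z n) := by
  simp [terminationTime, iInf_lt_iff]

/-- The probability of having left the loop by time `n` converges to the probability of
termination. -/
theorem tendsto_runMeasure_not_guard :
    Tendsto (fun n => P.runMeasure x {z | ¬ P.Guard (z n)}) atTop
      (𝓝 (P.runMeasure x {z | P.terminationTime z < ⊤})) := by
  have hU : {z | P.terminationTime z < ⊤} = ⋃ n, {z | ∃ i ≤ n, ¬ P.Guard (z i)} := by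
    ext z
    simp only [Set.mem_ofPred_eq, terminationTime_lt_top_iff, Set.mem_iUnion]
    exact ⟨fun ⟨n, hn⟩ => ⟨n, n, le_rfl, hn⟩, fun ⟨_, i, _, hi⟩ => ⟨i, hi⟩⟩
  have hmono : Monotone fun n => {z : ℕ → Fin r → ℤ | ∃ i ≤ n, ¬ P.Guard (z i)} :=
    fun n n' h z ⟨i, hi, hz⟩ => ⟨i, hi.trans h, hz⟩
  rw [hU]
  refine (tendsto_measure_iUnion_atTop hmono).congr fun n => measure_congr ?_
  filter_upwards [P.ae_runMeasure_absorbed x] with z hz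
  exact propext ⟨fun ⟨i, hi, h⟩ => hz i n hi h, fun h => ⟨n, le_rfl, h⟩⟩

/-- The tail sum formula for the expected runtime. -/
theorem expectedRuntime_eq_tsum :
    P.expectedRuntime x = ∑' n, P.runMeasure x {z | P.Guard (z n)} := by
  classical
  have hm : ∀ n, MeasurableSet {z : ℕ → Fin r → ℤ | P.Guard (z n)} :=
    fun n => measurableSet_state n {y | P.Guard y}
  simp_rw [← fun n => lintegral_indicator_one (μ := P.runMeasure x) (hm n)]
  rw [← lintegral_tsum fun n => (measurable_one.indicator (hm n)).aemeasurable, expectedRuntime]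
  refine lintegral_congr_ae ?_
  filter_upwards [P.ae_runMeasure_absorbed x] with z hz
  by_cases h : ∃ n, ¬ P.Guard (z n)
  · have hT : P.terminationTime z = (Nat.find h : ℕ∞) :=
      le_antisymm (iInf₂_le (f := fun (j : ℕ) (_ : ¬ P.Guard (z j)) => (j : ℕ∞)) _
        (Nat.find_spec h)) (le_iInf₂ fun j hj => by exact_mod_cast Nat.find_min' h hj)
    have hG : ∀ n, P.Guard (z n) ↔ n < Nat.find h := fun n =>
      ⟨fun hn => lt_of_not_ge fun hle => hz _ n hle (Nat.find_spec h) hn,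
        fun hn => not_not.1 (Nat.find_min h hn)⟩
    rw [hT, tsum_eq_sum (s := Finset.range (Nat.find h)) fun n hn =>
      Set.indicator_of_notMem (show z ∉ {z | P.Guard (z n)} from
        fun hzn => hn (Finset.mem_range.2 ((hG n).1 hzn))) 1]
    rw [Finset.sum_congr rfl fun n hn => Set.indicator_of_mem
      (show z ∈ {z | P.Guard (z n)} from (hG n).2 (Finset.mem_range.1 hn)) 1]
    simp only [Pi.one_apply, Finset.sum_const, Finset.card_range, nsmul_eq_mul, mul_one]
    rfl
  · have hT : P.terminationTime z = ⊤ :=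
      not_lt_top_iff.1 fun hlt => h ((P.terminationTime_lt_top_iff z).1 hlt)
    push Not at h
    simp [hT, h]

/-- The transition operator of the program: `(K f) y` is the expected value of `f` after one
iteration from the state `y`. -/
noncomputable def stepOperator (f : (Fin r → ℤ) → ℝ≥0∞) (y : Fin r → ℤ) : ℝ≥0∞ :=
  ∫⁻ y', f y' ∂P.stepMeasure y

theorem lintegral_runMeasure_add (f : (Fin r → ℤ) → ℝ≥0∞) (n N : ℕ) :
    ∫⁻ z, f (z (n + N)) ∂P.runMeasure x = ∫⁻ z, (P.stepOperator^[N] f) (z n) ∂P.runMeasure x := by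
  induction N generalizing n with
  | zero => rfl
  | succ N ih =>
    rw [← add_assoc, add_right_comm, ih, Function.iterate_succ_apply',
      P.lintegral_runMeasure_succ x n fun _ y => (P.stepOperator^[N] f) y]
    rfl

end ProbProgram

/-! ### One iteration of a random walk program -/

namespace RandomWalkProgram

variable (P : RandomWalkProgram)

theorem guard_iff (y : Fin 1 → ℤ) : P.toProbProgram.Guard y ↔ 0 < y 0 := by
  simp [ProbProgram.Guard, toProbProgram, dotProduct]

theorem not_guard_iff (y : Fin 1 → ℤ) : ¬ P.toProbProgram.Guard y ↔ y 0 ≤ 0 := by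
  rw [guard_iff, not_lt]

/-- Direct termination is a property of the constant `p'` alone, because the state `1` satisfies
the guard. -/
theorem pDirect_eq_zero (h : ¬ P.toProbProgram.HasDirectTermination) : P.pDirect = 0 := by
  by_contra h0
  exact h ⟨fun _ => 1, (P.guard_iff _).2 one_pos, pos_iff_ne_zero.2 h0⟩

theorem stepMeasure_of_nonpos {y : Fin 1 → ℤ} (hy : y 0 ≤ 0) :
    P.toProbProgram.stepMeasure y = Measure.dirac y := by
  rw [ProbProgram.stepMeasure, if_neg ((P.not_guard_iff y).2 hy)]

theorem lintegral_step_of_nonpos {y : Fin 1 → ℤ} (hy : y 0 ≤ 0) (f : (Fin 1 → ℤ) → ℝ≥0∞) :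
    ∫⁻ y', f y' ∂P.toProbProgram.stepMeasure y = f y := by
  rw [P.stepMeasure_of_nonpos hy, lintegral_dirac]

variable {P}

theorem lintegral_step_of_pos (hp : P.pDirect = 0) {y : Fin 1 → ℤ} (hy : 0 < y 0)
    (f : (Fin 1 → ℤ) → ℝ≥0∞) :
    ∫⁻ y', f y' ∂P.toProbProgram.stepMeasure y
      = ∑ j ∈ Finset.Icc (-(P.k : ℤ)) P.m, (P.p j : ℝ≥0∞) * f (y + fun _ => j) := by
  rw [ProbProgram.stepMeasure, if_pos ((P.guard_iff y).2 hy)]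
  simp only [toProbProgram, hp, zero_smul, add_zero]
  rw [Finset.sum_image fun i _ j _ h => congrFun h 0, lintegral_finsetSum_measure]
  refine Finset.sum_congr rfl fun j _ => ?_
  rw [lintegral_smul_measure, lintegral_dirac]
  rfl

theorem sum_p (hp : P.pDirect = 0) :
    ∑ j ∈ Finset.Icc (-(P.k : ℤ)) P.m, (P.p j : ℝ) = 1 := by
  have h := P.sum_eq_one
  rw [hp, add_zero] at h
  exact_mod_cast h

/-- The expected value of a nonnegative real function after one iteration. -/
theorem lintegral_step_ofReal (hp : P.pDirect = 0) {y : Fin 1 → ℤ} (hy : 0 < y 0) {F : ℤ → ℝ}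
    (hF : ∀ j ∈ Finset.Icc (-(P.k : ℤ)) P.m, 0 ≤ F (y 0 + j)) :
    ∫⁻ y', ENNReal.ofReal (F (y' 0)) ∂P.toProbProgram.stepMeasure y
      = ENNReal.ofReal (∑ j ∈ Finset.Icc (-(P.k : ℤ)) P.m, P.p j * F (y 0 + j)) := by
  rw [lintegral_step_of_pos hp hy,
    ENNReal.ofReal_sum_of_nonneg fun j hj =>
      mul_nonneg (P.p j).coe_nonneg (hF j hj)]
  refine Finset.sum_congr rfl fun j _ => ?_
  rw [ENNReal.ofReal_mul (P.p j).coe_nonneg, ENNReal.ofReal_coe_nnreal]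
  rfl

/-- One iteration increases the program variable by at most `m`. -/
theorem ae_step_le (hp : P.pDirect = 0) (y : Fin 1 → ℤ) :
    ∀ᵐ y' ∂P.toProbProgram.stepMeasure y, y' 0 ≤ y 0 + P.m := by
  rcases le_or_gt (y 0) 0 with hy | hy
  · rw [P.stepMeasure_of_nonpos hy, ae_dirac_eq]
    simp
  · have h := lintegral_step_of_pos hp hy fun y' => if y' 0 ≤ y 0 + P.m then 0 else 1
    rw [Finset.sum_eq_zero fun j hj => by simp [(Finset.mem_Icc.1 hj).2],
      lintegral_eq_zero_iff .of_discrete] at h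
    filter_upwards [h] with y' hy'
    by_contra hcon
    simp [hcon] at hy'

/-- The program variable shifted by `k`, the largest decrease, and truncated at `0`. It stays a
martingale under zero drift despite the truncation: an iteration from a positive state leads to a
state above `-k`, where the truncation has no effect. -/
noncomputable def shifted (P : RandomWalkProgram) (y : Fin 1 → ℤ) : ℝ≥0∞ :=
  ENNReal.ofReal ((y 0 : ℝ) + P.k)

theorem lintegral_step_shifted_of_pos (hp : P.pDirect = 0) {y : Fin 1 → ℤ} (hy : 0 < y 0) :
    0 ≤ (y 0 : ℝ) + P.k + P.drift ∧
    ∫⁻ y', P.shifted y' ∂P.toProbProgram.stepMeasure y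
      = ENNReal.ofReal ((y 0 : ℝ) + P.k + P.drift) := by
  have hF : ∀ j ∈ Finset.Icc (-(P.k : ℤ)) P.m, 0 ≤ (((y 0 + j : ℤ) : ℝ) + P.k) := fun j hj => by
    have : 0 ≤ y 0 + j + P.k := by have := (Finset.mem_Icc.1 hj).1; omega
    exact_mod_cast this
  have hsum : ∑ j ∈ Finset.Icc (-(P.k : ℤ)) P.m, P.p j * (((y 0 + j : ℤ) : ℝ) + P.k)
      = (y 0 : ℝ) + P.k + P.drift := by
    calc _ = ((y 0 : ℝ) + P.k) * ∑ j ∈ Finset.Icc (-(P.k : ℤ)) P.m, (P.p j : ℝ) + P.drift := by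
          rw [drift, Finset.mul_sum, ← Finset.sum_add_distrib]
          refine Finset.sum_congr rfl fun j _ => ?_
          push_cast
          ring
      _ = _ := by rw [sum_p hp, mul_one]
  refine ⟨hsum ▸ Finset.sum_nonneg fun j hj => mul_nonneg (P.p j).2 (hF j hj), ?_⟩
  rw [← hsum]
  exact lintegral_step_ofReal hp hy (F := fun i => (i : ℝ) + P.k) hF

/-! ### Negative drift -/

/-- Foster's drift argument: each iteration from a positive state decreases the expected value of
`shifted` by `-drift`, so the expected number of iterations is at most its initial value
divided by `-drift`. -/
theorem past_of_drift_neg (hp : P.pDirect = 0) (hd : P.drift < 0) : P.toProbProgram.PAST := by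
  classical
  intro x
  have hstep : ∀ y, ∫⁻ y', P.shifted y' ∂P.toProbProgram.stepMeasure y
      + ENNReal.ofReal (-P.drift) * {y | P.toProbProgram.Guard y}.indicator 1 y = P.shifted y := by
    intro y
    rcases le_or_gt (y 0) 0 with hy | hy
    · rw [P.lintegral_step_of_nonpos hy, Set.indicator_of_notMem
        (show y ∉ {y | P.toProbProgram.Guard y} from (P.not_guard_iff y).2 hy), mul_zero, add_zero]
    · obtain ⟨h0, h⟩ := lintegral_step_shifted_of_pos hp hy
      rw [h, Set.indicator_of_mem
        (show y ∈ {y | P.toProbProgram.Guard y} from (P.guard_iff y).2 hy), Pi.one_apply, mul_one,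
        ← ENNReal.ofReal_add h0 (by linarith), shifted]
      congr 1
      ring
  have hdec : ∀ n, ∫⁻ z, P.shifted (z (n + 1)) ∂P.toProbProgram.runMeasure x
      + ENNReal.ofReal (-P.drift)
        * P.toProbProgram.runMeasure x {z | P.toProbProgram.Guard (z n)}
      = ∫⁻ z, P.shifted (z n) ∂P.toProbProgram.runMeasure x := by
    intro n
    have hm : MeasurableSet {z : ℕ → Fin 1 → ℤ | P.toProbProgram.Guard (z n)} :=
      ProbProgram.measurableSet_state n {y | P.toProbProgram.Guard y}
    rw [P.toProbProgram.lintegral_runMeasure_succ x n fun _ y => P.shifted y,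
      ← lintegral_indicator_one hm, ← lintegral_const_mul _ (measurable_one.indicator hm),
      ← lintegral_add_right _ ((measurable_one.indicator hm).const_mul _)]
    exact lintegral_congr fun z => hstep (z n)
  have hsum : ∀ n, ∫⁻ z, P.shifted (z n) ∂P.toProbProgram.runMeasure x
      + ENNReal.ofReal (-P.drift)
        * ∑ i ∈ Finset.range n, P.toProbProgram.runMeasure x {z | P.toProbProgram.Guard (z i)}
      = P.shifted x := by
    intro n
    induction n with
    | zero => simp [P.toProbProgram.lintegral_runMeasure_zero x P.shifted]
    | succ n ih =>
      rw [Finset.sum_range_succ, mul_add, ← ih, ← hdec n]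
      ring
  have hε : ENNReal.ofReal (-P.drift) ≠ 0 := by simpa using hd
  rw [P.toProbProgram.expectedRuntime_eq_tsum]
  refine lt_of_le_of_lt (ENNReal.tsum_le_of_sum_range_le
    (c := P.shifted x / ENNReal.ofReal (-P.drift)) fun n => ?_)
    (ENNReal.div_lt_top ENNReal.ofReal_ne_top hε)
  rw [ENNReal.le_div_iff_mul_le (.inl hε) (.inl ENNReal.ofReal_ne_top), mul_comm]
  exact le_add_self.trans_eq (hsum n)

/-! ### Positive drift -/

/-- The generating function `∑ p j * t ^ j` has value `1` and derivative `drift` at `t = 1`, so it is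
below `1` just to the left of `1`. -/
theorem exists_geometric_supermartingale (hp : P.pDirect = 0) (hd : 0 < P.drift) :
    ∃ θ : ℝ, 0 < θ ∧ θ < 1 ∧ ∑ j ∈ Finset.Icc (-(P.k : ℤ)) P.m, P.p j * θ ^ j ≤ 1 := by
  set φ : ℝ → ℝ := fun t => ∑ j ∈ Finset.Icc (-(P.k : ℤ)) P.m, P.p j * t ^ j with hφ
  have hφ1 : φ 1 = 1 := by simpa [hφ] using sum_p hp
  have hderiv : HasDerivAt φ P.drift 1 := by
    have h := HasDerivAt.fun_sum (u := Finset.Icc (-(P.k : ℤ)) P.m) fun j _ =>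
      (hasDerivAt_zpow j (1 : ℝ) (.inl one_ne_zero)).const_mul (P.p j : ℝ)
    convert! h using 1
    exact Finset.sum_congr rfl fun j _ => by simp [mul_comm]
  have hslope := (hasDerivAt_iff_tendsto_slope_left_right.1 hderiv).1
  have h0 : ∀ᶠ t : ℝ in 𝓝[<] 1, 0 < t := nhdsWithin_le_nhds (lt_mem_nhds one_pos)
  obtain ⟨θ, hs, hθ0, hθ1⟩ := ((hslope.eventually (lt_mem_nhds hd)).and
    (h0.and self_mem_nhdsWithin)).exists
  refine ⟨θ, hθ0, hθ1, ?_⟩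
  rw [slope_def_field, hφ1] at hs
  by_contra! hcon
  exact absurd hs
    (div_nonpos_of_nonneg_of_nonpos (by linarith) (sub_nonpos.2 (le_of_lt hθ1))).not_gt

/-- `θ ^ z n` is a supermartingale that is at least `1` after termination, so the walk from `1`
terminates with probability at most `θ`. -/
theorem not_ast_of_drift_pos (hp : P.pDirect = 0) (hd : 0 < P.drift) :
    ¬ P.toProbProgram.AST := by
  obtain ⟨θ, hθ0, hθ1, hθ⟩ := exists_geometric_supermartingale hp hd
  intro hast
  let x : Fin 1 → ℤ := fun _ => 1
  let h : (Fin 1 → ℤ) → ℝ≥0∞ := fun y => ENNReal.ofReal (θ ^ (y 0))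
  have hstep : ∀ y, ∫⁻ y', h y' ∂P.toProbProgram.stepMeasure y ≤ h y := by
    intro y
    rcases le_or_gt (y 0) 0 with hy | hy
    · exact (P.lintegral_step_of_nonpos hy h).le
    · rw [lintegral_step_ofReal hp hy (F := fun i => θ ^ i) fun j _ => (zpow_pos hθ0 _).le]
      refine ENNReal.ofReal_le_ofReal ?_
      calc ∑ j ∈ Finset.Icc (-(P.k : ℤ)) P.m, P.p j * θ ^ (y 0 + j)
          = θ ^ (y 0) * ∑ j ∈ Finset.Icc (-(P.k : ℤ)) P.m, P.p j * θ ^ j := by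
            rw [Finset.mul_sum]
            exact Finset.sum_congr rfl fun j _ => by rw [zpow_add₀ hθ0.ne']; ring
        _ ≤ θ ^ (y 0) * 1 := by gcongr
        _ = _ := mul_one _
  have hle : ∀ n, ∫⁻ z, h (z n) ∂P.toProbProgram.runMeasure x ≤ ENNReal.ofReal θ := by
    intro n
    induction n with
    | zero =>
      rw [P.toProbProgram.lintegral_runMeasure_zero x h]
      simp [h, x]
    | succ n ih =>
      rw [P.toProbProgram.lintegral_runMeasure_succ x n fun _ y => h y]
      refine le_trans (lintegral_mono fun z => ?_) ih
      exact hstep (z n)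
  have hμ : ∀ n, P.toProbProgram.runMeasure x
      {z : ℕ → Fin 1 → ℤ | ¬ P.toProbProgram.Guard (z n)} ≤ ENNReal.ofReal θ := by
    intro n
    have hms : MeasurableSet {z : ℕ → Fin 1 → ℤ | ¬ P.toProbProgram.Guard (z n)} :=
      ProbProgram.measurableSet_state n {y | ¬ P.toProbProgram.Guard y}
    rw [← lintegral_indicator_one hms]
    refine (lintegral_mono (Set.indicator_le' (fun z hz => ?_) fun _ _ => zero_le)).trans (hle n)
    exact ENNReal.one_le_ofReal.2
      (one_le_zpow_of_nonpos₀ hθ0 hθ1.le ((P.not_guard_iff (z n)).1 hz))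
  have hlim := le_of_tendsto' (P.toProbProgram.tendsto_runMeasure_not_guard x) hμ
  rw [hast x] at hlim
  exact absurd (ENNReal.one_le_ofReal.1 hlim) hθ1.not_ge

/-! ### Zero drift -/

theorem lintegral_step_shifted (hp : P.pDirect = 0) (hd : P.drift = 0) (y : Fin 1 → ℤ) :
    ∫⁻ y', P.shifted y' ∂P.toProbProgram.stepMeasure y = P.shifted y := by
  rcases le_or_gt (y 0) 0 with hy | hy
  · exact P.lintegral_step_of_nonpos hy P.shifted
  · rw [(lintegral_step_shifted_of_pos hp hy).2, hd, add_zero, shifted]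

theorem lintegral_runMeasure_shifted (hp : P.pDirect = 0) (hd : P.drift = 0) (x : Fin 1 → ℤ)
    (n : ℕ) : ∫⁻ z, P.shifted (z n) ∂P.toProbProgram.runMeasure x = P.shifted x := by
  induction n with
  | zero => exact P.toProbProgram.lintegral_runMeasure_zero x P.shifted
  | succ n ih =>
    rw [P.toProbProgram.lintegral_runMeasure_succ x n fun _ y => P.shifted y]
    simp_rw [lintegral_step_shifted hp hd, ih]

/-- After `n` iterations from the state `1` the variable is at most `1 + m * n`, and its
positive part has mean at least `1`; so the probability of still running is at least `1 / (1 + m * n)`, which is not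
summable. -/
theorem not_past_of_drift_eq_zero (hp : P.pDirect = 0) (hd : P.drift = 0) (hm : 0 < P.m) :
    ¬ P.toProbProgram.PAST := by
  classical
  intro hpast
  let x : Fin 1 → ℤ := fun _ => 1
  have hbound : ∀ᵐ (z : ℕ → Fin 1 → ℤ) ∂P.toProbProgram.runMeasure x,
      ∀ n : ℕ, z n 0 ≤ 1 + P.m * n := by
    have h0 : ∀ᵐ z ∂P.toProbProgram.runMeasure x, z 0 0 ≤ 1 := by
      have h := P.toProbProgram.lintegral_runMeasure_zero x fun y => if y 0 ≤ 1 then 0 else 1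
      have hme : Measurable fun y : Fin 1 → ℤ => if y 0 ≤ 1 then (0 : ℝ≥0∞) else 1 := .of_discrete
      have hmz : Measurable fun z : ℕ → Fin 1 → ℤ => if z 0 0 ≤ 1 then (0 : ℝ≥0∞) else 1 :=
        hme.comp (measurable_pi_apply 0)
      simp only [x, le_refl, if_true] at h
      rw [lintegral_eq_zero_iff hmz] at h
      filter_upwards [h] with z hz
      by_contra hcon
      simp [hcon] at hz
    filter_upwards [h0, P.toProbProgram.ae_runMeasure_step x (ae_step_le hp)] with z hz0 hz n
    induction n with
    | zero => simpa using hz0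
    | succ n ih =>
      push_cast
      linarith [hz n]
  have hlow : ∀ n : ℕ, (1 : ℝ≥0∞) ≤ ENNReal.ofReal (1 + P.m * n)
      * P.toProbProgram.runMeasure x {z | P.toProbProgram.Guard (z n)} := by
    intro n
    have hms : MeasurableSet {z : ℕ → Fin 1 → ℤ | P.toProbProgram.Guard (z n)} :=
      ProbProgram.measurableSet_state n {y | P.toProbProgram.Guard y}
    have hmean := lintegral_runMeasure_shifted hp hd x n
    have hle : ∫⁻ z, P.shifted (z n) ∂P.toProbProgram.runMeasure x
        ≤ ∫⁻ z, ENNReal.ofReal (1 + P.m * n)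
            * {z | P.toProbProgram.Guard (z n)}.indicator 1 z + ENNReal.ofReal P.k
          ∂P.toProbProgram.runMeasure x := by
      refine lintegral_mono_ae ?_
      filter_upwards [hbound] with z hz
      rcases le_or_gt (z n 0) 0 with hy | hy
      · refine le_add_self.trans' (ENNReal.ofReal_le_ofReal ?_)
        have : (z n 0 : ℝ) ≤ 0 := by exact_mod_cast hy
        linarith
      · rw [Set.indicator_of_mem (show z ∈ {z | P.toProbProgram.Guard (z n)} from
          (P.guard_iff _).2 hy), Pi.one_apply, mul_one,
          ← ENNReal.ofReal_add (by positivity) (by positivity)]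
        refine ENNReal.ofReal_le_ofReal ?_
        have : (z n 0 : ℝ) ≤ 1 + P.m * n := by exact_mod_cast hz n
        linarith
    rw [hmean, lintegral_add_right _ measurable_const,
      lintegral_const_mul _ (measurable_one.indicator hms), lintegral_indicator_one hms,
      lintegral_const, measure_univ, mul_one, shifted,
      ENNReal.ofReal_add (by simp [x]) (by positivity)] at hle
    simpa [x] using (ENNReal.add_le_add_iff_right ENNReal.ofReal_ne_top).1 hle
  have hfin := hpast x
  rw [P.toProbProgram.expectedRuntime_eq_tsum] at hfin
  have hsummable := ENNReal.summable_toReal hfin.ne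
  have hharm : Summable fun n : ℕ => (P.m : ℝ) * (P.toProbProgram.runMeasure x
      {z | P.toProbProgram.Guard (z n)}).toReal := hsummable.mul_left _
  refine (summable_nat_add_iff 1).not.2 Real.not_summable_one_div_natCast
    (hharm.of_nonneg_of_le (fun n => by positivity) fun n => ?_)
  have h1 := ENNReal.toReal_mono (ENNReal.mul_ne_top ENNReal.ofReal_ne_top (measure_ne_top _ _))
    (hlow n)
  rw [ENNReal.toReal_mul, ENNReal.toReal_ofReal (by positivity), ENNReal.toReal_one] at h1
  -- As `1 ≤ m`, the bound `1 + m * n` is at most `m * (n + 1)`, a multiple of the harmonic term.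
  have hm1 : (1 : ℝ) ≤ P.m := by exact_mod_cast hm
  push_cast
  rw [div_le_iff₀ (by positivity)]
  refine h1.trans ?_
  rw [mul_right_comm]
  gcongr
  nlinarith

/-- From a state at most `k * N`, the run consisting of steps `-k` only terminates within `N`
iterations. -/
theorem pow_le_stepOperator_iterate (hp : P.pDirect = 0) (N : ℕ) {y : Fin 1 → ℤ}
    (hy : y 0 ≤ P.k * N) :
    (P.p (-(P.k : ℤ)) : ℝ≥0∞) ^ N ≤
      (P.toProbProgram.stepOperator^[N] ({y | ¬ P.toProbProgram.Guard y}.indicator 1)) y := by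
  have hp1 : (P.p (-(P.k : ℤ)) : ℝ≥0∞) ≤ 1 := by
    have h := P.sum_eq_one
    rw [hp, add_zero] at h
    have hle := Finset.single_le_sum (f := P.p) (fun j _ => zero_le)
      (Finset.mem_Icc.2 ⟨le_rfl, by omega⟩ : -(P.k : ℤ) ∈ Finset.Icc (-(P.k : ℤ)) P.m)
    exact_mod_cast hle.trans h.le
  induction N generalizing y with
  | zero =>
    rw [pow_zero, Function.iterate_zero_apply,
      Set.indicator_of_mem ((P.not_guard_iff y).2 (by simpa using hy)), Pi.one_apply]
  | succ N ih =>
    rw [Function.iterate_succ_apply', ProbProgram.stepOperator]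
    rcases le_or_gt (y 0) 0 with hy0 | hy0
    · rw [P.lintegral_step_of_nonpos hy0]
      exact (pow_le_pow_right_of_le_one' hp1 N.le_succ).trans (ih (hy0.trans (by positivity)))
    · rw [lintegral_step_of_pos hp hy0, pow_succ']
      refine le_trans ?_ (Finset.single_le_sum (fun j _ => zero_le)
        (Finset.mem_Icc.2 ⟨le_rfl, by omega⟩ : -(P.k : ℤ) ∈ Finset.Icc (-(P.k : ℤ)) P.m))
      gcongr
      refine ih ?_
      push_cast at hy
      simp only [Pi.add_apply]
      linarith

theorem stepOperator_iterate_of_nonpos (f : (Fin 1 → ℤ) → ℝ≥0∞) (N : ℕ) {y : Fin 1 → ℤ}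
    (hy : y 0 ≤ 0) : (P.toProbProgram.stepOperator^[N] f) y = f y := by
  induction N with
  | zero => rfl
  | succ N ih =>
    rw [Function.iterate_succ_apply', ProbProgram.stepOperator, P.lintegral_step_of_nonpos hy, ih]

/-- Up to an error of order `1 / N`, by Markov's inequality for the martingale `shifted`, a walk
that is still running is at most `k * N`, and then terminates within `N` iterations with a
probability bounded below. As the probabilities of having terminated converge, the probability of
running forever is at most a constant times `1 / N`, for every `N`. -/
theorem ast_of_drift_eq_zero (hp : P.pDirect = 0) (hd : P.drift = 0) (hk : 0 < P.k) :
    P.toProbProgram.AST := by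
  classical
  intro x
  set μ := P.toProbProgram.runMeasure x
  set a : ℕ → ℝ := fun n => μ.real {z | ¬ P.toProbProgram.Guard (z n)}
  set A : ℝ := μ.real {z | P.toProbProgram.terminationTime z < ⊤}
  set C : ℝ := (P.shifted x).toReal
  have hlim : Tendsto a atTop (𝓝 A) :=
    (ENNReal.tendsto_toReal (measure_ne_top _ _)).comp
      (P.toProbProgram.tendsto_runMeasure_not_guard x)
  have hA1 : A ≤ 1 := measureReal_le_one
  have hmarkov : ∀ N n : ℕ, N * μ.real {z | (P.k * N : ℤ) < z n 0} ≤ C := by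
    intro N n
    have h := mul_meas_ge_le_lintegral (μ := μ) (f := fun z => P.shifted (z n))
      ((Measurable.of_discrete (f := P.shifted)).comp (measurable_pi_apply n)) N
    rw [lintegral_runMeasure_shifted hp hd x n] at h
    have h' : (N : ℝ≥0∞) * μ {z | (P.k * N : ℤ) < z n 0} ≤ P.shifted x := by
      refine le_trans ?_ h
      gcongr with z
      intro hz
      rw [shifted, ← ENNReal.ofReal_natCast]
      refine ENNReal.ofReal_le_ofReal ?_
      -- As `1 ≤ k`, a variable above `k * N` gives a value of `shifted` of at least `N`.
      have hkN : (N : ℤ) ≤ P.k * N := le_mul_of_one_le_left (by positivity) (by exact_mod_cast hk)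
      exact_mod_cast (show (N : ℤ) ≤ z n 0 + P.k by omega)
    simpa [Measure.real] using
      ENNReal.toReal_mono (show P.shifted x ≠ ∞ from ENNReal.ofReal_ne_top) h'
  have hstep : ∀ N n : ℕ, a n + (P.p (-(P.k : ℤ)) : ℝ) ^ N
      * (1 - a n - μ.real {z | (P.k * N : ℤ) < z n 0}) ≤ a (n + N) := by
    intro N n
    have hm1 : MeasurableSet {z : ℕ → Fin 1 → ℤ | ¬ P.toProbProgram.Guard (z n)} :=
      ProbProgram.measurableSet_state n {y | ¬ P.toProbProgram.Guard y}
    have hm2 : MeasurableSet {z : ℕ → Fin 1 → ℤ | 0 < z n 0 ∧ z n 0 ≤ P.k * N} :=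
      ProbProgram.measurableSet_state n {y | 0 < y 0 ∧ y 0 ≤ P.k * N}
    have hm3 : MeasurableSet {z : ℕ → Fin 1 → ℤ | ¬ P.toProbProgram.Guard (z (n + N))} :=
      ProbProgram.measurableSet_state (n + N) {y | ¬ P.toProbProgram.Guard y}
    -- Runs that have terminated stay so; runs at `0 < z n ≤ k * N` terminate by time `n + N` with
    -- probability at least `p (-k) ^ N`.
    have hE : μ {z | ¬ P.toProbProgram.Guard (z n)} + (P.p (-(P.k : ℤ)) : ℝ≥0∞) ^ N
          * μ {z | 0 < z n 0 ∧ z n 0 ≤ P.k * N}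
        ≤ μ {z | ¬ P.toProbProgram.Guard (z (n + N))} := by
      rw [← lintegral_indicator_one hm1, ← lintegral_indicator_one hm2,
        ← lintegral_indicator_one hm3, ← lintegral_const_mul _ (measurable_one.indicator hm2),
        ← lintegral_add_left (measurable_one.indicator hm1)]
      have h := P.toProbProgram.lintegral_runMeasure_add x
        ({y | ¬ P.toProbProgram.Guard y}.indicator 1) n N
      refine le_trans (lintegral_mono fun z => ?_) h.symm.le
      rcases le_or_gt (z n 0) 0 with hy | hy
      · rw [stepOperator_iterate_of_nonpos _ _ hy]
        simp [hy.not_gt, (P.not_guard_iff (z n)).2 hy]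
      · have hg := (P.guard_iff (z n)).2 hy
        by_cases hyN : z n 0 ≤ P.k * N
        · simpa [Set.indicator_apply, hg, hy, hyN] using pow_le_stepOperator_iterate hp N hyN
        · simp [hg, hyN]
    have hR := ENNReal.toReal_mono (measure_ne_top _ _) hE
    rw [ENNReal.toReal_add (measure_ne_top _ _) (ENNReal.mul_ne_top
      (ENNReal.pow_ne_top ENNReal.coe_ne_top) (measure_ne_top _ _)), ENNReal.toReal_mul,
      ENNReal.toReal_pow, ENNReal.coe_toReal] at hR
    have hcover : 1 ≤ a n + μ.real {z | 0 < z n 0 ∧ z n 0 ≤ P.k * N}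
        + μ.real {z | (P.k * N : ℤ) < z n 0} := by
      rw [← probReal_univ (μ := μ)]
      refine le_trans (measureReal_mono (fun z _ => ?_))
        ((measureReal_union_le _ _).trans (add_le_add_left (measureReal_union_le _ _) _))
      simp only [Set.mem_union, Set.mem_ofPred_eq, P.not_guard_iff]
      omega
    refine le_trans (add_le_add le_rfl (mul_le_mul_of_nonneg_left ?_ (by positivity))) hR
    change _ ≤ μ.real _
    linarith
  have hbound : ∀ N : ℕ, N * (1 - A) ≤ C := by
    intro N
    rcases N.eq_zero_or_pos with rfl | hN
    · simp [C]
    have hN' : (0 : ℝ) < N := by exact_mod_cast hN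
    have hδ : (0 : ℝ) < (P.p (-(P.k : ℤ)) : ℝ) ^ N := pow_pos (P.p_neg_k_pos hk) N
    have h1 : ∀ n, a n + (P.p (-(P.k : ℤ)) : ℝ) ^ N * (1 - a n - C / N) ≤ a (n + N) := by
      intro n
      refine le_trans ?_ (hstep N n)
      gcongr
      rw [le_div_iff₀' hN']
      exact hmarkov N n
    -- In the limit the gain `a (n + N) - a n` vanishes.
    have h2 : A + (P.p (-(P.k : ℤ)) : ℝ) ^ N * (1 - A - C / N) ≤ A :=
      le_of_tendsto_of_tendsto' (hlim.add (((tendsto_const_nhds.sub hlim).sub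
        tendsto_const_nhds).const_mul _)) (hlim.comp (tendsto_add_atTop_nat N)) h1
    have h3 : 1 - A - C / N ≤ 0 := by
      by_contra! hcon
      linarith [mul_pos hδ hcon]
    rw [← le_div_iff₀' hN']
    linarith
  have hA : A = 1 := by
    refine le_antisymm hA1 ?_
    by_contra! hcon
    obtain ⟨N, hN⟩ := exists_nat_gt (C / (1 - A))
    rw [div_lt_iff₀ (by linarith)] at hN
    exact hN.not_ge (hbound N)
  rw [← ENNReal.ofReal_toReal (measure_ne_top μ _)]
  exact (congrArg ENNReal.ofReal hA).trans ENNReal.ofReal_one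

/-- A nontrivial walk with zero drift moves both upwards and downwards with positive
probability. -/
theorem pos_of_drift_eq_zero (hnontrivial : ¬ P.IsTrivial) (hp : P.pDirect = 0)
    (hd : P.drift = 0) : 0 < P.m ∧ 0 < P.k := by
  have hsum := P.sum_eq_one
  rw [hp, add_zero] at hsum
  rw [drift] at hd
  by_contra hcon
  rcases Nat.eq_zero_or_pos P.m with hm | hm <;> rcases Nat.eq_zero_or_pos P.k with hk | hk
  · exact hnontrivial ⟨hm, hk, by simpa [hm, hk] using hsum⟩
  · have h := (Finset.sum_eq_zero_iff_of_nonpos fun j hj => mul_nonpos_of_nonpos_of_nonneg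
      (by have := (Finset.mem_Icc.1 hj).2; exact_mod_cast (by omega : j ≤ 0)) (P.p j).2).1 hd
      (-(P.k : ℤ)) (Finset.mem_Icc.2 ⟨le_rfl, by omega⟩)
    have h0 := P.p_neg_k_pos hk
    simp [hk.ne', h0.ne'] at h
  · have h := (Finset.sum_eq_zero_iff_of_nonneg fun j hj => mul_nonneg
      (by have := (Finset.mem_Icc.1 hj).1; exact_mod_cast (by omega : 0 ≤ j)) (P.p j).2).1 hd
      (P.m : ℤ) (Finset.mem_Icc.2 ⟨by omega, le_rfl⟩)
    have h0 := P.p_m_pos hm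
    simp [hm.ne', h0.ne'] at h
  · exact hcon ⟨hm, hk⟩

end RandomWalkProgram

theorem mainTheorem1 (P : RandomWalkProgram) (hnontrivial : ¬ P.IsTrivial)
    (hdirect : ¬ P.toProbProgram.HasDirectTermination) :
    (0 < P.drift → ¬ P.toProbProgram.AST) ∧
    (P.drift = 0 → P.toProbProgram.AST ∧ ¬ P.toProbProgram.PAST) ∧
    (P.drift < 0 → P.toProbProgram.PAST) := by
  have hp := P.pDirect_eq_zero hdirect
  refine ⟨RandomWalkProgram.not_ast_of_drift_pos hp, fun hd => ?_,
    RandomWalkProgram.past_of_drift_neg hp⟩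
  obtain ⟨hm, hk⟩ := RandomWalkProgram.pos_of_drift_eq_zero hnontrivial hp hd
  exact ⟨RandomWalkProgram.ast_of_drift_eq_zero hp hd hk,
    RandomWalkProgram.not_past_of_drift_eq_zero hp hd hm⟩
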